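/- **Setting.** Let $G=(V,E)$ be a directed graph (parallel edges allowed) and $I$ a finite set of commodities. Each commodity $i\in I$ has an origin and a destination vertex, a demand $Q_i\ge 0$, and a finite nonempty set $\mathcal P_i$ of directed simple paths from its origin to its destination (for instance all of them). A path is identified with its set of edges when we write $e\in p$, $p\cap q$, $q\setminus p$. Let $$\mathcal F_Q=\Bigl\{f=(f_{i,p})_{i\in I,\,p\in\mathcal P_i}\ :\ f_{i,p}\ge 0,\ \sum_{p\in\mathcal P_i}f_{i,p}=Q_i\ \text{for all } i\in I\Bigr\}$$ be the set of demand-feasible path flows. For $f\in\mathcal F_Q$, $p,q\in\mathcal P_i$ and $0<\varepsilon\le f_{i,p}$ let $f_{i,p\to q}(\varepsilon)=f+\varepsilon(1_{i,q}-1_{i,p})\in\mathcal F_Q$. A cost structure is a map $c:\mathcal F_Q\to\mathbb R_{\ge 0}^{I\times E}$, $f\mapsto (c_{i,e}(f))_{i\in I,e\in E}$; the cost of a path $p\in\mathcal P_i$ is $c_{i,p}(f)=\sum_{e\in p}c_{i,e}(f)$. The upper hull of $c_{i,e}$ is $$\bar c_{i,e}(f)=\lim_{\varepsilon\downarrow 0}\sup\{c_{i,e}(x)\mid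 x\in\mathcal F_Q,\ \|x-f\|<\varepsilon\}.$$ The cost structure $c$ is called *weakly regular* if for all $f\in\mathcal F_Q$, $i\in I$ and $p\in\mathcal P_i$ with $f_{i,p}>0$, $$c_{i,p}(f)\le\min_{q\in\mathcal P_i}\Bigl(\sum_{e\in p\cap q}c_{i,e}(f)+\sum_{e\in q\setminus p}\bar c_{i,e}(f)\Bigr)\ \Longrightarrow\ c_{i,p}(f)\le\min_{q\in\mathcal P_i}\liminf_{\varepsilon\downarrow 0}c_{i,q}(f_{i,p\to q}(\varepsilon)).$$ A flow $f\in\mathcal F_Q$ is a *Bernstein–Smith equilibrium* (BS-equilibrium) if for all $i\in I$, all $p\in\mathcal P_i$ with $f_{i,p}>0$ and all $q\in\mathcal P_i$, $$c_{i,p}(f)\le\liminf_{\varepsilon\downarrow 0}c_{i,q}(f_{i,p\to q}(\varepsilon)).$$ **Theorem.** If $c:\mathcal F_Q\to\mathbb R_{\ge 0}^{I\times E}$ is bounded (there is $M$ with $c_{i,e}(f)\le M$ for all $i,e,f$), weakly regular, and every $c_{i,e}$ is lower semicontinuous on $\mathcal F_Q$, then a BS-equilibrium exists. -/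

import Mathlib

open scoped NNReal ENNReal Topology

/-- A directed multigraph with vertex type `V` and edge type `E`. -/
structure DiMultigraph (V E : Type*) where
  tail : E → V
  head : E → V

namespace DiMultigraph

variable {V E : Type*} (G : DiMultigraph V E)

/-- The list of edges `es` is a directed walk from `u` to `w`. -/
def IsWalk : V → V → List E → Prop
  | u, w, [] => u = w
  | u, w, e :: es => G.tail e = u ∧ IsWalk (G.head e) w es

/-- The list of edges `es` is a directed simple path from `u` to `w`:
a walk that visits no vertex twice. -/
def IsPath (u w : V) (es : List E) : Prop :=
  G.IsWalk u w es ∧ (u :: es.map G.head).Nodup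

end DiMultigraph

/-- A multi-commodity routing network: a directed graph and, for every commodity `i`, an origin,
a destination, a demand `Q i ≥ 0`, and a finite nonempty set `P i` of paths from the origin to the
destination (the strategies of the commodity, e.g. all such paths), given by their edge lists. -/
structure RoutingNetwork (V E I : Type*) where
  graph : DiMultigraph V E
  source : I → V
  sink : I → V
  Q : I → ℝ≥0
  P : I → Finset (List E)
  nonempty_P : ∀ i, (P i).Nonempty
  isPath_of_mem : ∀ i, ∀ p ∈ P i, graph.IsPath (source i) (sink i) p

namespace RoutingNetwork

variable {V E I : Type*} [DecidableEq E] [DecidableEq I]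
variable (N : RoutingNetwork V E I)

/-- The commodity-path pairs `(i, p)` with `p ∈ P i`. -/
abbrev Pairs : Type _ := Σ i : I, {p : List E // p ∈ N.P i}

/-- The demand-feasible path flows. -/
def demandFeasible : Set (N.Pairs → ℝ) :=
  {f | (∀ x, 0 ≤ f x) ∧ ∀ i, ∑ p : {p : List E // p ∈ N.P i}, f ⟨i, p⟩ = N.Q i}

/-- The vector `f + ε (1_{i,q} - 1_{i,p})`. -/
def shift (f : N.Pairs → ℝ) (i : I) (p q : {p : List E // p ∈ N.P i}) (ε : ℝ) : N.Pairs → ℝ :=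
  f + ε • (Pi.single (⟨i, q⟩ : N.Pairs) (1 : ℝ) - Pi.single (⟨i, p⟩ : N.Pairs) (1 : ℝ))

theorem shift_mem {f : N.Pairs → ℝ} (hf : f ∈ N.demandFeasible) (i : I)
    (p q : {p : List E // p ∈ N.P i}) {ε : ℝ} (h0 : 0 ≤ ε) (h1 : ε ≤ f ⟨i, p⟩) :
    N.shift f i p q ε ∈ N.demandFeasible := by
  refine ⟨fun x => ?_, fun j => ?_⟩
  · have hx := hf.1 x
    have hq : (0 : ℝ) ≤ Pi.single (M := fun _ : N.Pairs => ℝ) ⟨i, q⟩ 1 x := by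
      by_cases h : x = ⟨i, q⟩
      · subst h; simp
      · simp [Pi.single_eq_of_ne h]
    simp only [shift, Pi.add_apply, Pi.smul_apply, Pi.sub_apply, smul_eq_mul]
    by_cases h : x = ⟨i, p⟩
    · subst h
      simp only [Pi.single_eq_same]
      nlinarith [mul_nonneg h0 hq]
    · simp only [Pi.single_eq_of_ne h]
      nlinarith [mul_nonneg h0 hq]
  · have key : ∀ r : {p : List E // p ∈ N.P i},
        ∑ s : {p : List E // p ∈ N.P j},
          Pi.single (M := fun _ : N.Pairs => ℝ) ⟨i, r⟩ (1 : ℝ) ⟨j, s⟩ = if j = i then 1 else 0 := by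
      intro r
      by_cases h : j = i
      · subst h
        simp [Pi.single_apply]
      · rw [if_neg h]
        refine Finset.sum_eq_zero fun s _ => Pi.single_eq_of_ne ?_ _
        intro h'
        exact h (congrArg Sigma.fst h')
    simp only [shift, Pi.add_apply, Pi.smul_apply, Pi.sub_apply, smul_eq_mul,
      Finset.sum_add_distrib, ← Finset.mul_sum, Finset.sum_sub_distrib, key]
    rw [hf.2 j]
    ring

/-- The `ε`-deviation `f_{i,p→q}(ε)`, a demand-feasible flow for `0 < ε ≤ f_{i,p}`. -/
def deviation (f : N.demandFeasible) (i : I) (p q : {p : List E // p ∈ N.P i})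
    (ε : Set.Ioc (0 : ℝ) (f.1 ⟨i, p⟩)) : N.demandFeasible :=
  ⟨N.shift f.1 i p q ε, N.shift_mem f.2 i p q ε.2.1.le ε.2.2⟩

/-- A cost structure assigns to every demand-feasible flow, commodity and edge a cost in `[0,∞)`. -/
abbrev CostStructure : Type _ := N.demandFeasible → I → E → ℝ≥0

variable [Fintype I] {N}

namespace CostStructure

variable (c : N.CostStructure)

/-- `c_{i,p}(f) = ∑_{e ∈ p} c_{i,e}(f)`. -/
def pathCost (i : I) (p : {p : List E // p ∈ N.P i}) (f : N.demandFeasible) : ℝ≥0 :=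
  ∑ e ∈ p.1.toFinset, c f i e

/-- The upper hull of `c_{i,e}` at `f`: the limit as `ε ↓ 0` (an infimum, by monotonicity) of the
suprema of `c_{i,e}` over the `ε`-balls around `f` in the set of demand-feasible flows. -/
noncomputable def upperHull (i : I) (e : E) (f : N.demandFeasible) : ℝ≥0∞ :=
  ⨅ (ε : ℝ) (_ : 0 < ε), ⨆ x ∈ Metric.ball f ε, (c x i e : ℝ≥0∞)

/-- `∑_{e ∈ p ∩ q} c_{i,e}(f) + ∑_{e ∈ q \ p} c̄_{i,e}(f)`. -/
noncomputable def hullCost (i : I) (p q : {p : List E // p ∈ N.P i}) (f : N.demandFeasible) :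
    ℝ≥0∞ :=
  ∑ e ∈ p.1.toFinset ∩ q.1.toFinset, (c f i e : ℝ≥0∞) +
    ∑ e ∈ q.1.toFinset \ p.1.toFinset, c.upperHull i e f

/-- `liminf_{ε ↓ 0} c_{i,q}(f_{i,p→q}(ε))`, where `ε` ranges over `(0, f_{i,p}]`. -/
noncomputable def deviationCost (i : I) (p q : {p : List E // p ∈ N.P i})
    (f : N.demandFeasible) : ℝ≥0∞ :=
  Filter.liminf (fun ε : Set.Ioc (0 : ℝ) (f.1 ⟨i, p⟩) =>
      (c.pathCost i q (N.deviation f i p q ε) : ℝ≥0∞))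
    (Filter.comap Subtype.val (𝓝[>] (0 : ℝ)))

/-- Every `c_{i,e}` is lower semicontinuous on the set of demand-feasible flows. -/
def IsLowerSemicontinuous : Prop :=
  ∀ i e, LowerSemicontinuous fun f : N.demandFeasible => c f i e

/-- The functions `c_{i,e}` are bounded. -/
def IsBounded : Prop :=
  ∃ M : ℝ≥0, ∀ f i e, c f i e ≤ M

/-- Weak regularity of a cost structure. The infima are minima over the finite nonempty set `P i`. -/
def WeaklyRegular : Prop :=
  ∀ (f : N.demandFeasible) (i : I) (p : {p : List E // p ∈ N.P i}), 0 < f.1 ⟨i, p⟩ →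
    (c.pathCost i p f : ℝ≥0∞) ≤ (⨅ q : {p : List E // p ∈ N.P i}, c.hullCost i p q f) →
    (c.pathCost i p f : ℝ≥0∞) ≤ ⨅ q : {p : List E // p ∈ N.P i}, c.deviationCost i p q f

/-- `f` is an equilibrium in the sense of Bernstein and Smith. -/
def IsBSEquilibrium (f : N.demandFeasible) : Prop :=
  ∀ (i : I) (p : {p : List E // p ∈ N.P i}), 0 < f.1 ⟨i, p⟩ →
    ∀ q : {p : List E // p ∈ N.P i}, (c.pathCost i p f : ℝ≥0∞) ≤ c.deviationCost i p q f

end CostStructure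

end RoutingNetwork

/-! Lower semicontinuous costs are approximated from below by continuous ones, the Lipschitz
envelopes. Each approximation has a Wardrop equilibrium, and by compactness a subsequence of these
converges to some flow `f`. A path `p` with positive flow in `f` is eventually used, hence is
eventually no dearer than any `q`. Edges common to `p` and `q` must be cancelled before the limit is
taken: on `p \ q` lower semicontinuity then bounds the limit below by the cost at `f`, and on `q \
p` the envelopes lie below the costs, whose limit is bounded above by the upper hull. This is the
premise of weak regularity (`exists_pathCost_le_hullCost`), whose conclusion is the equilibrium
condition.

Wardrop equilibria come from a continuous game on the simplex of mixtures of path profiles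
(`exists_stdSimplex_support_subset_argmin`). Colour each mixture by a cheapest profile; a KKM-type
statement finds a small cluster carrying every colour of non-negligible weight, and continuity makes
each profile in the support of a limit point cheapest. The clusters are the dominating sets of
Scarf's lemma (`exists_dominating_rainbow`), proved by a parity count. -/

/-! ### Scarf's combinatorial lemma. -/

/-- `σ` is dominating for the family of utilities `u` if no point beats, in every order `u i`,
some point of `σ`. -/
def IsDominating {J S : Type*} (u : J → S → ℕ) (σ : Finset S) : Prop :=
  ∀ y, ∃ i, ∀ x ∈ σ, u i y ≤ u i x

theorem IsDominating.mono {J S : Type*} {u : J → S → ℕ} {σ τ : Finset S}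
    (h : IsDominating u σ) (hτ : τ ⊆ σ) : IsDominating u τ := fun y =>
  (h y).imp fun _ hi x hx => hi x (hτ hx)

/-- Used to show that a facet with one point fewer than there are orders cannot lose two orders: too
few minimizers would remain to cover it. -/
theorem card_add_two_le_of_surjOn_avoiding_two {J S : Type*} [Fintype J] [DecidableEq J]
    [DecidableEq S] {τ : Finset S} {μ : J → S} {k l : J} (hkl : k ≠ l)
    (h : ∀ x ∈ τ, ∃ m, m ≠ k ∧ m ≠ l ∧ μ m = x) : τ.card + 2 ≤ Fintype.card J := by
  have hsub : τ ⊆ ((Finset.univ.erase k).erase l).image μ := by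
    intro x hx
    obtain ⟨m, hk, hl, rfl⟩ := h x hx
    exact Finset.mem_image_of_mem _ (by simp [hk, hl])
  have h1 := (Finset.card_le_card hsub).trans Finset.card_image_le
  have h2 : ((Finset.univ.erase k).erase l).card + 1 = (Finset.univ.erase k).card :=
    Finset.card_erase_add_one (by simp [hkl.symm])
  have h3 : (Finset.univ.erase k).card + 1 = (Finset.univ : Finset J).card :=
    Finset.card_erase_add_one (by simp)
  rw [Finset.card_univ] at h3
  omega

/-- A dominating set with one element fewer than there are orders, and for which no order is
exhausted, has exactly two dominating one-point extensions. -/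
theorem card_dominating_extensions {J S : Type*} [Fintype J] [DecidableEq J] [Fintype S]
    [DecidableEq S] {u : J → S → ℕ} (hu : ∀ i, Function.Injective (u i)) {τ : Finset S}
    (hne : τ.Nonempty) (hτ : IsDominating u τ) (hcard : τ.card + 1 = Fintype.card J)
    (hM : ∀ k, ∃ y, ∀ l, l ≠ k → ∃ x ∈ τ, u l x < u l y) [DecidablePred (IsDominating u)] :
    (Finset.univ.filter fun y => y ∉ τ ∧ IsDominating u (insert y τ)).card = 2 := by
  classical
  choose μ hμmem hμ using fun i => τ.exists_min_image (u i) hne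
  have hμeq : ∀ i x, x ∈ τ → (∀ z ∈ τ, u i x ≤ u i z) → μ i = x := fun i x hx h =>
    hu i (le_antisymm (hμ i x hx) (h _ (hμmem i)))
  have hsurj : ∀ x ∈ τ, ∃ i, μ i = x := fun x hx =>
    (hτ x).imp fun i hi => hμeq i x hx hi
  have hM' : ∀ k, ∃ y, ∀ l, l ≠ k → u l (μ l) < u l y := fun k =>
    (hM k).imp fun y hy l hl => by
      obtain ⟨x, hx, hxy⟩ := hy l hl
      exact (hμ l x hx).trans_lt hxy
  have hmax : ∀ k, ∃ y, (∀ l, l ≠ k → u l (μ l) < u l y) ∧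
      ∀ z, (∀ l, l ≠ k → u l (μ l) < u l z) → u k z ≤ u k y := by
    intro k
    obtain ⟨y, hy, hy'⟩ :=
      (Finset.univ.filter fun y => ∀ l, l ≠ k → u l (μ l) < u l y).exists_max_image (u k)
        ((hM' k).imp fun y hy => by simpa using hy)
    exact ⟨y, by simpa using hy, fun z hz => hy' z (by simpa using hz)⟩
  -- Among the points above the minimum of `τ` in every order but `k`, `Y k` is highest in order
  -- `k`; no other point can extend `τ` by becoming the new minimum of order `k` alone.
  choose Y hY hYmax using hmax
  have hYk : ∀ k, ∀ x ∈ τ, u k (Y k) ≤ u k x := by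
    intro k
    obtain ⟨l, hl⟩ := hτ (Y k)
    by_cases hlk : l = k
    · exact hlk ▸ hl
    · exact absurd (hl _ (hμmem l)) (not_le.2 (hY k l hlk))
  -- Exactly one order is redundant in covering `τ` by minimizers. Either of `i` and `j` can be
  -- given to a new point, which yields the two extensions.
  obtain ⟨i, -, j, -, hij, hμij⟩ := Finset.exists_ne_map_eq_of_card_lt_of_maps_to
    (s := (Finset.univ : Finset J)) (t := τ) (by rw [Finset.card_univ]; omega)
    (fun k _ => hμmem k)
  have hext : ∀ k k', k ≠ k' → μ k = μ k' → Y k ∉ τ ∧ IsDominating u (insert (Y k) τ) := by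
    intro k k' hkk' hμk
    constructor
    · intro hmem
      obtain ⟨l, hl⟩ := hsurj _ hmem
      by_cases hlk : l = k
      · subst hlk
        have := hY l k' hkk'.symm
        rw [← hl, hμk] at this
        exact lt_irrefl _ this
      · have := hY k l hlk
        rw [hl] at this
        exact lt_irrefl _ this
    · intro z
      by_contra! hz
      have hzM : ∀ l, l ≠ k → u l (μ l) < u l z := by
        intro l hl
        obtain ⟨x, hx, hxz⟩ := hz l
        rcases Finset.mem_insert.1 hx with rfl | hx
        · exact (hY k l hl).trans hxz
        · exact (hμ l x hx).trans_lt hxz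
      obtain ⟨x, hx, hxz⟩ := hz k
      rcases Finset.mem_insert.1 hx with rfl | hx
      · exact absurd (hYmax k z hzM) (not_le.2 hxz)
      · exact absurd (hYmax k z hzM) (not_le.2 ((hYk k x hx).trans_lt hxz))
  rw [Finset.card_eq_two]
  refine ⟨Y i, Y j, ?_, ?_⟩
  · intro h
    have h1 := hY i j hij.symm
    rw [h] at h1
    exact absurd (hYk j _ (hμmem j)) (not_le.2 h1)
  · ext y
    simp only [Finset.mem_filter, Finset.mem_univ, true_and, Finset.mem_insert,
      Finset.mem_singleton]
    constructor
    · rintro ⟨hy, hdom⟩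
      obtain ⟨k, hk⟩ := hdom y
      have hsurj' : ∀ x ∈ τ, ∃ m, (¬ ∀ z ∈ τ, u m y ≤ u m z) ∧ μ m = x := by
        intro x hx
        obtain ⟨m, hm⟩ := hdom x
        refine ⟨m, fun h => hy ?_, hμeq m x hx fun z hz => hm z (Finset.mem_insert_of_mem hz)⟩
        have := hu m (le_antisymm (h x hx) (hm y (Finset.mem_insert_self _ _)))
        exact this ▸ hx
      have hkτ : ∀ z ∈ τ, u k y ≤ u k z := fun z hz => hk z (Finset.mem_insert_of_mem hz)
      have hyM : ∀ l, l ≠ k → u l (μ l) < u l y := by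
        intro l hl
        by_contra! hle
        have hlτ : ∀ z ∈ τ, u l y ≤ u l z := fun z hz => hle.trans (hμ l z hz)
        have := card_add_two_le_of_surjOn_avoiding_two (τ := τ) (μ := μ) hl fun x hx => by
          obtain ⟨m, hm, hmx⟩ := hsurj' x hx
          exact ⟨m, fun h => hm (h ▸ hlτ), fun h => hm (h ▸ hkτ), hmx⟩
        omega
      have hyY : y = Y k := by
        refine hu k (le_antisymm (hYmax k y hyM) ?_)
        obtain ⟨l, hl⟩ := hdom (Y k)
        by_cases hlk : l = k
        · exact hlk ▸ hl y (Finset.mem_insert_self _ _)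
        · exact absurd (hl _ (Finset.mem_insert_of_mem (hμmem l))) (not_le.2 (hY k l hlk))
      by_contra! hne'
      have hki : k ≠ i := fun h => hne'.1 (h ▸ hyY)
      have hkj : k ≠ j := fun h => hne'.2 (h ▸ hyY)
      have := card_add_two_le_of_surjOn_avoiding_two (τ := τ) (μ := μ) hki fun x hx => by
        obtain ⟨m, hm, hmx⟩ := hsurj' x hx
        by_cases hmi : m = i
        · exact ⟨j, hkj.symm, hij.symm, by rw [← hμij, ← hmi, hmx]⟩
        · exact ⟨m, fun h => hm (h ▸ hkτ), hmi, hmx⟩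
      omega
    · rintro (rfl | rfl)
      · exact hext i j hij hμij
      · exact hext j i hij.symm hμij.symm

/-- A set with as many elements as there are colours has an odd number of elements whose removal
leaves exactly the colours other than `a` only if it carries all colours. -/
theorem image_eq_univ_of_odd_card {J S : Type*} [Fintype J] [DecidableEq J] [DecidableEq S]
    {color : S → J} {a : J} {σ : Finset S} (hcard : σ.card = Fintype.card J)
    (hodd : Odd (σ.filter fun x => (σ.erase x).image color = Finset.univ.erase a).card) :
    σ.image color = Finset.univ := by
  by_contra hne
  obtain ⟨x, hx⟩ := Finset.card_pos.1 hodd.pos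
  obtain ⟨hxσ, hximg⟩ := Finset.mem_filter.1 hx
  have hinj : ∀ z ∈ σ, (σ.erase z).image color = Finset.univ.erase a →
      Set.InjOn color (σ.erase z : Finset S) := by
    intro z hz himg
    rw [← Finset.card_image_iff, himg, Finset.card_erase_of_mem (Finset.mem_univ _),
      Finset.card_erase_of_mem hz, hcard, Finset.card_univ]
  have himg : σ.image color = insert (color x) (Finset.univ.erase a) := by
    rw [← hximg, ← Finset.image_insert, Finset.insert_erase hxσ]
  have hxa : color x ≠ a := by
    intro h
    rw [h, Finset.insert_erase (Finset.mem_univ a)] at himg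
    exact hne himg
  obtain ⟨x', hx', hxx'⟩ : ∃ x' ∈ σ.erase x, color x' = color x := by
    rw [← Finset.mem_image, hximg]
    simp [hxa]
  have hx'x : x' ≠ x := (Finset.mem_erase.1 hx').1
  have hx'σ : x' ∈ σ := (Finset.mem_erase.1 hx').2
  have hna : ∀ z ∈ σ, color z ≠ a := by
    intro z hz h
    have := Finset.mem_image_of_mem color hz
    rw [himg, h] at this
    simp [hxa.symm] at this
  -- The elements `x` and `x'` share a colour. Removing any third element keeps both, which would
  -- break injectivity of the colouring on the remainder.
  have htwo : (σ.filter fun x => (σ.erase x).image color = Finset.univ.erase a) = {x, x'} := by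
    ext z
    simp only [Finset.mem_filter, Finset.mem_insert, Finset.mem_singleton]
    constructor
    · rintro ⟨hz, hzimg⟩
      by_contra! h
      exact hx'x (hinj z hz hzimg (by simp [h.2.symm, hx'σ]) (by simp [h.1.symm, hxσ]) hxx')
    · rintro (rfl | rfl)
      · exact ⟨hxσ, hximg⟩
      · refine ⟨hx'σ, ?_⟩
        ext k
        simp only [Finset.mem_image, Finset.mem_erase, Finset.mem_univ, and_true]
        constructor
        · rintro ⟨w, ⟨-, hw⟩, rfl⟩
          exact hna w hw
        · intro hk
          have : k ∈ (σ.erase x).image color := by rw [hximg]; simp [hk]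
          obtain ⟨w, hw, rfl⟩ := Finset.mem_image.1 this
          by_cases hwz : w = z
          · exact ⟨x, ⟨hwz ▸ (hwz ▸ hx'x).symm, hxσ⟩, by rw [hwz, hxx']⟩
          · exact ⟨w, ⟨hwz, (Finset.mem_erase.1 hw).2⟩, rfl⟩
  rw [htwo, Finset.card_pair hx'x.symm] at hodd
  exact absurd hodd (by decide)

/-- Scarf's combinatorial lemma: if `T` is extended by one dummy point `inr i` for each order `u i`,
which is least for `u i` and above `T` for all other orders, then some dominating set carries all
colours. -/
theorem exists_dominating_rainbow {J T : Type*} [Fintype J] [DecidableEq J] [Nonempty J]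
    [Fintype T] [DecidableEq T] [Nonempty T] {u : J → T ⊕ J → ℕ}
    (hu : ∀ i, Function.Injective (u i)) (hmin : ∀ i t, u i (Sum.inr i) < u i (Sum.inl t))
    (hmax : ∀ i j t, j ≠ i → u i (Sum.inl t) < u i (Sum.inr j)) (color : T ⊕ J → J)
    (hcolor : ∀ j, color (Sum.inr j) = j) :
    ∃ σ : Finset (T ⊕ J), IsDominating u σ ∧ σ.image color = Finset.univ := by
  classical
  obtain ⟨a⟩ := ‹Nonempty J›
  let D : Finset (Finset (T ⊕ J)) := Finset.univ.filter fun τ =>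
    IsDominating u τ ∧ τ.card + 1 = Fintype.card J ∧ τ.image color = Finset.univ.erase a
  let R : Finset (Finset (T ⊕ J)) := Finset.univ.filter fun σ =>
    IsDominating u σ ∧ σ.card = Fintype.card J
  let exts : Finset (T ⊕ J) → Finset (T ⊕ J) := fun τ =>
    Finset.univ.filter fun y => y ∉ τ ∧ IsDominating u (insert y τ)
  let rem : Finset (T ⊕ J) → Finset (T ⊕ J) := fun σ =>
    σ.filter fun x => (σ.erase x).image color = Finset.univ.erase a
  let τ₀ : Finset (T ⊕ J) := (Finset.univ.erase a).image Sum.inr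
  -- Double count of incident pairs: doors (`D`) lack only colour `a`, rooms (`R`) are obtained by
  -- adding a point.
  have hcount : ∑ τ ∈ D, (exts τ).card = ∑ σ ∈ R, (rem σ).card := by
    rw [← Finset.card_sigma, ← Finset.card_sigma]
    refine Finset.card_bij' (fun z _ => ⟨insert z.2 z.1, z.2⟩) (fun z _ => ⟨z.1.erase z.2, z.2⟩)
      ?_ ?_ ?_ ?_
    · rintro ⟨τ, y⟩ h
      simp only [Finset.mem_sigma, Finset.mem_filter, Finset.mem_univ, true_and, D, exts, R,
        rem] at h ⊢
      obtain ⟨⟨-, hc, himg⟩, hy, hdom⟩ := h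
      refine ⟨⟨hdom, by rw [Finset.card_insert_of_notMem hy, hc]⟩, Finset.mem_insert_self _ _, ?_⟩
      rw [Finset.erase_insert hy, himg]
    · rintro ⟨σ, x⟩ h
      simp only [Finset.mem_sigma, Finset.mem_filter, Finset.mem_univ, true_and, D, exts, R,
        rem] at h ⊢
      obtain ⟨⟨hdom, hc⟩, hx, himg⟩ := h
      refine ⟨⟨hdom.mono (Finset.erase_subset _ _), ?_, himg⟩, by simp, ?_⟩
      · rw [Finset.card_erase_add_one hx, hc]
      · rwa [Finset.insert_erase hx]
    · rintro ⟨τ, y⟩ h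
      simp only [Finset.mem_sigma, Finset.mem_filter, Finset.mem_univ, true_and, D, exts] at h
      simp [Finset.erase_insert h.2.1]
    · rintro ⟨σ, x⟩ h
      simp only [Finset.mem_sigma, Finset.mem_filter, R, rem] at h
      simp [Finset.insert_erase h.2.1]
  have hτ₀card : τ₀.card + 1 = Fintype.card J := by
    rw [Finset.card_image_of_injective _ Sum.inr_injective,
      Finset.card_erase_add_one (Finset.mem_univ a), Finset.card_univ]
  have hτ₀img : τ₀.image color = Finset.univ.erase a := by
    rw [Finset.image_image]
    exact (Finset.image_congr fun j _ => hcolor j).trans Finset.image_id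
  obtain ⟨t₀, ht₀⟩ := Finite.exists_max fun t : T => u a (Sum.inl t)
  have hdom₀ : IsDominating u (insert (Sum.inl t₀) τ₀) := by
    rintro (t | j)
    · refine ⟨a, fun x hx => ?_⟩
      rcases Finset.mem_insert.1 hx with rfl | hx
      · exact ht₀ t
      · obtain ⟨j, hj, rfl⟩ := Finset.mem_image.1 hx
        exact (hmax a j t (Finset.mem_erase.1 hj).1).le
    · refine ⟨j, fun x _ => ?_⟩
      rcases x with t | k
      · exact (hmin j t).le
      · by_cases hkj : k = j
        · rw [hkj]
        · exact ((hmin j t₀).trans (hmax j k t₀ hkj)).le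
  have hτ₀ : τ₀ ∈ D := by
    simp only [D, Finset.mem_filter, Finset.mem_univ, true_and]
    exact ⟨hdom₀.mono (Finset.subset_insert _ _), hτ₀card, hτ₀img⟩
  -- The boundary door: since `τ₀` holds every dummy but that of `a`, a real point can be dominated
  -- only in order `a`, which forces the top real point of that order.
  have hext₀ : (exts τ₀).card = 1 := by
    rw [Finset.card_eq_one]
    refine ⟨Sum.inl t₀, ?_⟩
    ext y
    simp only [exts, Finset.mem_filter, Finset.mem_univ, true_and, Finset.mem_singleton]
    constructor
    · rintro ⟨hy, hdom⟩
      obtain ⟨i, hi⟩ := hdom (Sum.inl t₀)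
      have hia : i = a := by
        by_contra hia
        exact absurd (hi (Sum.inr i) (by simp [τ₀, hia])) (not_le.2 (hmin i t₀))
      subst hia
      have hi' := hi y (Finset.mem_insert_self _ _)
      rcases y with t | j
      · exact hu i (le_antisymm (ht₀ t) hi')
      · by_cases hji : j = i
        · subst hji
          exact absurd hi' (not_le.2 (hmin j t₀))
        · exact absurd (by simp [τ₀, hji]) hy
    · rintro rfl
      exact ⟨by simp [τ₀], hdom₀⟩
  have hext : ∀ τ ∈ D.erase τ₀, (exts τ).card = 2 := by
    intro τ hτ
    obtain ⟨hne, hτ⟩ := Finset.mem_erase.1 hτ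
    simp only [D, Finset.mem_filter, Finset.mem_univ, true_and] at hτ
    obtain ⟨hdom, hcard, himg⟩ := hτ
    -- A door made of dummies only would be `τ₀`, because dummies carry their own colours. A real
    -- point lies below all foreign dummies, so no order is exhausted.
    obtain ⟨t, ht⟩ : ∃ t : T, Sum.inl t ∈ τ := by
      by_contra! hno
      refine hne (Finset.eq_of_subset_of_card_le ?_ (by omega))
      rintro (t | j) hx
      · exact absurd hx (hno t)
      · have := Finset.mem_image_of_mem color hx
        rw [himg, hcolor] at this
        exact Finset.mem_image_of_mem _ this
    exact card_dominating_extensions hu ⟨_, ht⟩ hdom hcard fun k =>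
      ⟨Sum.inr k, fun l hl => ⟨_, ht, hmax l k t hl.symm⟩⟩
  by_contra! hno
  have heven : Even (∑ σ ∈ R, (rem σ).card) := by
    refine Finset.even_sum _ fun σ hσ => ?_
    simp only [R, Finset.mem_filter, Finset.mem_univ, true_and] at hσ
    by_contra hodd
    exact hno σ hσ.1 (image_eq_univ_of_odd_card hσ.2 (Nat.not_even_iff_odd.1 hodd))
  rw [← hcount, ← Finset.add_sum_erase _ _ hτ₀, hext₀, Finset.sum_congr rfl hext,
    Finset.sum_const, smul_eq_mul] at heven
  rw [Nat.even_iff] at heven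
  omega

/-! ### Rainbow clusters in a simplex. -/

/-- Every colouring of the lattice points of a dilated simplex by its coordinates admits a small
cluster of points carrying every coordinate that is not small on the cluster. -/
theorem exists_lattice_point_near_colors {J : Type*} [Fintype J] [DecidableEq J] [Nonempty J]
    (N : ℕ) (color : (J → ℕ) → J) :
    ∃ x : J → ℕ, ∑ i, x i = N ∧ ∀ i, x i ≤ Fintype.card J ∨
      ∃ y : J → ℕ, ∑ i, y i = N ∧ color y = i ∧
        ∀ k, x k ≤ y k + Fintype.card J ∧ y k ≤ x k + Fintype.card J := by
  classical
  let T := {x // x ∈ (Finset.univ : Finset J).piAntidiag N}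
  have hT : ∀ x : J → ℕ, x ∈ (Finset.univ : Finset J).piAntidiag N ↔ ∑ i, x i = N := by
    intro x
    simp [Finset.mem_piAntidiag]
  obtain ⟨j₀⟩ := ‹Nonempty J›
  have : Nonempty J := ⟨j₀⟩
  have : Nonempty T := ⟨⟨Pi.single j₀ N, (hT _).2 (by simp)⟩⟩
  let K := Fintype.card T
  let e := Fintype.equivFin T
  have hle : ∀ (t : T) i, t.1 i ≤ N := fun t i =>
    (Finset.single_le_sum (f := t.1) (fun _ _ => Nat.zero_le _) (Finset.mem_univ i)).trans
      ((hT _).1 t.2).le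
  -- Order `i` compares the `i`-th coordinates, with ties broken by the enumeration `e`, whose
  -- values are below `K`. The leading `1` leaves `0` for the order's own dummy.
  let u : J → T ⊕ J → ℕ := fun i => Sum.elim (fun t => 1 + (t.1 i * K + e t))
    (fun j => if j = i then 0 else 1 + (N * K + K) + Fintype.equivFin J j)
  have hlt : ∀ i t, u i (Sum.inl t) < 1 + (N * K + K) := by
    intro i t
    have h1 := Nat.mul_le_mul_right K (hle t i)
    have h2 : (e t : ℕ) < K := (e t).2
    simp only [u, Sum.elim_inl]
    omega
  have hmin : ∀ i t, u i (Sum.inr i) < u i (Sum.inl t) := by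
    intro i t
    simp [u]
  have hge : ∀ i j, j ≠ i → u i (Sum.inr j) = 1 + (N * K + K) + Fintype.equivFin J j := by
    intro i j hj
    simp [u, hj]
  have hmax : ∀ i j t, j ≠ i → u i (Sum.inl t) < u i (Sum.inr j) := by
    intro i j t hj
    rw [hge i j hj]
    exact (hlt i t).trans_le (Nat.le_add_right _ _)
  have hu : ∀ i, Function.Injective (u i) := by
    rintro i (t | j) (t' | j') h
    · have h' : t.1 i * K + e t = t'.1 i * K + e t' := by simpa [u] using h
      have h'' := congrArg (· % K) h'
      have ht : (e t : ℕ) % K = e t := Nat.mod_eq_of_lt (e t).2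
      have ht' : (e t' : ℕ) % K = e t' := Nat.mod_eq_of_lt (e t').2
      simp only [Nat.mul_add_mod_self_right, ht, ht'] at h''
      rw [e.injective (Fin.ext h'')]
    · by_cases hj : j' = i
      · exact absurd h (by rw [hj]; exact (hmin i t).ne')
      · exact absurd h (hmax i j' t hj).ne
    · by_cases hj : j = i
      · exact absurd h (by rw [hj]; exact (hmin i t').ne)
      · exact absurd h (hmax i j t' hj).ne'
    · by_cases hj : j = i <;> by_cases hj' : j' = i
      · rw [hj, hj']
      · rw [hge i j' hj', hj] at h
        simp only [u, Sum.elim_inr, if_true] at h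
        omega
      · rw [hge i j hj, hj'] at h
        simp only [u, Sum.elim_inr, if_true] at h
        omega
      · rw [hge i j hj, hge i j' hj'] at h
        exact congrArg _ ((Fintype.equivFin J).injective (Fin.ext (Nat.add_left_cancel h)))
  obtain ⟨σ, hdom, himg⟩ := exists_dominating_rainbow hu hmin hmax
    (Sum.elim (fun t : T => color t.1) id) (fun j => rfl)
  let C : Finset J := Finset.univ.filter fun i => Sum.inr i ∉ σ
  let A : Finset T := Finset.univ.filter fun t => Sum.inl t ∈ σ
  have hC : ∀ i, i ∈ C ↔ Sum.inr i ∉ σ := fun i => by simp [C]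
  have hA : ∀ t, t ∈ A ↔ Sum.inl t ∈ σ := fun t => by simp [A]
  have hcol : ∀ i ∈ C, ∃ t ∈ A, color t.1 = i := by
    intro i hi
    have : i ∈ σ.image (Sum.elim (fun t : T => color t.1) id) := by rw [himg]; simp
    obtain ⟨t | j, hs, hsi⟩ := Finset.mem_image.1 this
    · exact ⟨t, (hA t).2 hs, hsi⟩
    · simp only [Sum.elim_inr, id] at hsi
      exact absurd (hsi ▸ hs) ((hC i).1 hi)
  have hkey : ∀ t : T, ∃ i ∈ C, ∀ x ∈ A, t.1 i ≤ x.1 i := by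
    intro t
    obtain ⟨i, hi⟩ := hdom (Sum.inl t)
    refine ⟨i, (hC i).2 fun h => absurd (hi _ h) (not_le.2 (hmin i t)), fun x hx => ?_⟩
    have h := hi _ ((hA x).1 hx)
    by_contra! hlt
    have h1 : (x.1 i + 1) * K ≤ t.1 i * K := Nat.mul_le_mul_right K hlt
    have h2 : (e x : ℕ) < K := (e x).2
    rw [add_mul] at h1
    simp only [u, Sum.elim_inl] at h
    omega
  obtain ⟨i₁, hi₁, -⟩ := hkey (Classical.arbitrary T)
  obtain ⟨x₀, hx₀, -⟩ := hcol i₁ hi₁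
  choose m hmA hm using fun i => A.exists_min_image (fun t => t.1 i) ⟨x₀, hx₀⟩
  -- Otherwise raising each minimum over `C` by one still fits in total `N`. Putting the slack on
  -- `i₁` gives a lattice point that exceeds the minimum in every coordinate of `C`, against
  -- domination. Hence the minima nearly exhaust `N`, and coordinates within the cluster vary by
  -- less than `C.card`.
  have hsum : N < ∑ i ∈ C, (m i).1 i + C.card := by
    by_contra! hle
    let y : J → ℕ := fun i => if i ∈ C then (m i).1 i + 1 else 0
    have hy : ∑ i, y i = ∑ i ∈ C, (m i).1 i + C.card := by
      simp [y, Finset.sum_add_distrib]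
    obtain ⟨r, hr⟩ := Nat.exists_eq_add_of_le hle
    obtain ⟨i, hi, hi'⟩ := hkey ⟨y + Pi.single i₁ r, (hT _).2 (by
      simp [Finset.sum_add_distrib, hy, hr])⟩
    have := hi' (m i) (hmA i)
    simp only [Pi.add_apply, y, if_pos hi] at this
    omega
  have hCcard : C.card ≤ Fintype.card J := Finset.card_le_univ C
  have hin : ∀ i ∈ C, ∀ x ∈ A, x.1 i ≤ (m i).1 i + Fintype.card J := by
    intro i hi x hx
    have h1 : ∑ k ∈ C, x.1 k ≤ N :=
      (Finset.sum_le_sum_of_subset (Finset.subset_univ C)).trans ((hT _).1 x.2).le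
    have h2 : ∑ k ∈ C.erase i, (m k).1 k ≤ ∑ k ∈ C.erase i, x.1 k :=
      Finset.sum_le_sum fun k _ => hm k x hx
    rw [← Finset.add_sum_erase _ _ hi] at h1 hsum
    omega
  have hout : ∀ i, i ∉ C → ∀ x ∈ A, x.1 i ≤ Fintype.card J := by
    intro i hi x hx
    have h1 : ∑ k ∈ insert i C, x.1 k ≤ N :=
      (Finset.sum_le_sum_of_subset (Finset.subset_univ _)).trans ((hT _).1 x.2).le
    have h2 : ∑ k ∈ C, (m k).1 k ≤ ∑ k ∈ C, x.1 k :=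
      Finset.sum_le_sum fun k _ => hm k x hx
    rw [Finset.sum_insert hi] at h1
    omega
  have hnear : ∀ x ∈ A, ∀ y ∈ A, ∀ k, x.1 k ≤ y.1 k + Fintype.card J := by
    intro x hx y hy k
    by_cases hk : k ∈ C
    · exact (hin k hk x hx).trans (Nat.add_le_add_right (hm k y hy) _)
    · exact (hout k hk x hx).trans (Nat.le_add_left _ _)
  refine ⟨x₀.1, (hT _).1 x₀.2, fun i => ?_⟩
  by_cases hi : i ∈ C
  · obtain ⟨t, ht, hti⟩ := hcol i hi
    exact Or.inr ⟨t.1, (hT _).1 t.2, hti, fun k => ⟨hnear _ hx₀ _ ht k, hnear _ ht _ hx₀ k⟩⟩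
  · exact Or.inl (hout i hi x₀ hx₀)

/-- Rescaling by `N` turns the lattice error `Fintype.card J` into at most `ε`. -/
theorem exists_stdSimplex_point_near_colors {J : Type*} [Fintype J] [Nonempty J]
    (color : stdSimplex ℝ J → J) {ε : ℝ} (hε : 0 < ε) :
    ∃ x : stdSimplex ℝ J, ∀ i, x.1 i ≤ ε ∨ ∃ y, color y = i ∧ dist y x ≤ ε := by
  classical
  obtain ⟨N, hN⟩ := exists_nat_gt ((Fintype.card J : ℝ) / ε)
  have hNpos : (0 : ℝ) < N := lt_of_le_of_lt (by positivity) hN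
  have hNε : (Fintype.card J : ℝ) / N ≤ ε := by
    rw [div_lt_iff₀ hε] at hN
    rw [div_le_iff₀ hNpos]
    linarith
  have hmem : ∀ x : J → ℕ, ∑ i, x i = N → (fun i => (x i : ℝ) / N) ∈ stdSimplex ℝ J := by
    intro x hx
    refine ⟨fun i => by positivity, ?_⟩
    rw [← Finset.sum_div, ← Nat.cast_sum, hx, div_self hNpos.ne']
  -- The default colour is never seen, since the points returned have coordinate sum `N`.
  obtain ⟨x, hx, h⟩ := exists_lattice_point_near_colors (J := J) N fun y =>
    if hy : ∑ i, y i = N then color ⟨_, hmem y hy⟩ else Classical.arbitrary J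
  refine ⟨⟨_, hmem x hx⟩, fun i => (h i).imp (fun hi => ?_) ?_⟩
  · refine le_trans ?_ hNε
    show (x i : ℝ) / N ≤ _
    gcongr
  · rintro ⟨y, hy, hyi, hd⟩
    rw [dif_pos hy] at hyi
    refine ⟨_, hyi, ?_⟩
    rw [Subtype.dist_eq, dist_pi_le_iff hε.le]
    intro k
    refine le_trans ?_ hNε
    have h1 : (x k : ℝ) ≤ y k + Fintype.card J := by exact_mod_cast (hd k).1
    have h2 : (y k : ℝ) ≤ x k + Fintype.card J := by exact_mod_cast (hd k).2
    rw [Real.dist_eq, ← sub_div, abs_div, abs_of_pos hNpos]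
    gcongr
    rw [abs_le]
    constructor <;> linarith

/-! ### Equilibria of continuous games on a simplex. -/

/-- A continuous population game on a simplex has a Nash equilibrium. -/
theorem exists_stdSimplex_support_subset_argmin {J : Type*} [Fintype J] [Nonempty J]
    {G : stdSimplex ℝ J → J → ℝ} (hG : ∀ j, Continuous fun x => G x j) :
    ∃ x : stdSimplex ℝ J, ∀ j, 0 < x.1 j → ∀ k, G x j ≤ G x k := by
  choose color hcolor using fun x => Finite.exists_min (G x)
  choose z hz using fun n : ℕ =>
    exists_stdSimplex_point_near_colors color (Nat.one_div_pos_of_nat (α := ℝ) (n := n))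
  have : CompactSpace (stdSimplex ℝ J) := isCompact_iff_compactSpace.1 (isCompact_stdSimplex ℝ J)
  obtain ⟨x, φ, hφ, hx⟩ := CompactSpace.tendsto_subseq z
  have hε : Filter.Tendsto (fun n => 1 / ((φ n : ℝ) + 1)) Filter.atTop (𝓝 0) :=
    tendsto_one_div_add_atTop_nhds_zero_nat.comp hφ.tendsto_atTop
  refine ⟨x, fun j hj k => ?_⟩
  have hxj : Filter.Tendsto (fun n => (z (φ n)).1 j) Filter.atTop (𝓝 (x.1 j)) :=
    (((continuous_apply j).comp continuous_subtype_val).tendsto x).comp hx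
  -- The alternative of a coordinate of size at most the tolerance dies out because `x.1 j` is
  -- positive, so points of colour `j` accumulate at `x`.
  have hev : ∀ᶠ n in Filter.atTop,
      ∃ y, color y = j ∧ dist y (z (φ n)) ≤ 1 / ((φ n : ℝ) + 1) := by
    filter_upwards [hε.eventually_lt hxj hj] with n hn
    exact (hz (φ n) j).resolve_left (not_le.2 hn)
  obtain ⟨n₀, hn₀⟩ := Filter.eventually_atTop.1 hev
  choose! y hyc hyd using hn₀
  have hdist : Filter.Tendsto (fun n => dist (z (φ n)) (y n)) Filter.atTop (𝓝 0) := by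
    refine squeeze_zero' (Filter.Eventually.of_forall fun _ => dist_nonneg) ?_ hε
    filter_upwards [Filter.eventually_ge_atTop n₀] with n hn
    rw [dist_comm]
    exact hyd n hn
  have hy : Filter.Tendsto y Filter.atTop (𝓝 x) := (tendsto_iff_of_dist hdist).1 hx
  refine le_of_tendsto_of_tendsto (((hG j).tendsto x).comp hy) (((hG k).tendsto x).comp hy) ?_
  filter_upwards [Filter.eventually_ge_atTop n₀] with n hn
  have := hcolor (y n) k
  rwa [hyc n hn] at this

/-! ### Lipschitz approximation from below. -/

/-- The largest `K`-Lipschitz minorant of a nonnegative function on a metric space. -/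
noncomputable def lipschitzEnvelope {X : Type*} [PseudoMetricSpace X] (g : X → ℝ≥0) (K : ℝ≥0)
    (x : X) : ℝ :=
  ⨅ y, ((g y : ℝ) + K * dist x y)

section lipschitzEnvelope

variable {X : Type*} [PseudoMetricSpace X] (g : X → ℝ≥0)

theorem lipschitzEnvelope_le_add (K : ℝ≥0) (x y : X) :
    lipschitzEnvelope g K x ≤ g y + K * dist x y :=
  ciInf_le (f := fun y => (g y : ℝ) + K * dist x y)
    ⟨0, by rintro _ ⟨y, rfl⟩; positivity⟩ y

theorem lipschitzEnvelope_le (K : ℝ≥0) (x : X) : lipschitzEnvelope g K x ≤ g x := by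
  simpa using lipschitzEnvelope_le_add g K x x

theorem continuous_lipschitzEnvelope (K : ℝ≥0) : Continuous (lipschitzEnvelope g K) := by
  refine (LipschitzWith.of_le_add_mul K fun x y => ?_).continuous
  have : Nonempty X := ⟨x⟩
  rw [← sub_le_iff_le_add]
  refine le_ciInf fun z => ?_
  have h1 := lipschitzEnvelope_le_add g K x z
  have h2 : (K : ℝ) * dist x z ≤ K * (dist x y + dist y z) := by
    gcongr
    exact dist_triangle _ _ _
  linarith

/-- Along a convergent sequence, Lipschitz envelopes with constants tending to infinity
asymptotically exceed every bound below the value of a lower semicontinuous function. -/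
theorem LowerSemicontinuousAt.eventually_le_lipschitzEnvelope {g : X → ℝ≥0} {x : X}
    (hg : LowerSemicontinuousAt g x) {ι : Type*} {l : Filter ι} {z : ι → X} {K : ι → ℝ≥0}
    (hz : Filter.Tendsto z l (𝓝 x)) (hK : Filter.Tendsto K l Filter.atTop) {a : ℝ}
    (ha : a < g x) : ∀ᶠ n in l, a ≤ lipschitzEnvelope g (K n) (z n) := by
  have : Nonempty X := ⟨x⟩
  rcases lt_or_ge a 0 with ha0 | ha0
  · exact Filter.Eventually.of_forall fun n => ha0.le.trans (le_ciInf fun y => by positivity)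
  lift a to ℝ≥0 using ha0
  obtain ⟨δ, hδ, hball⟩ := Metric.eventually_nhds_iff.1 (hg a (by exact_mod_cast ha))
  -- Points within `δ` of `x` have value above `a`. All others are at distance at least `δ / 2` from
  -- `z n`, so this threshold on `K` makes the penalty alone reach `a`.
  filter_upwards [hz (Metric.ball_mem_nhds x (half_pos hδ)),
    hK.eventually_ge_atTop (a / (δ / 2).toNNReal)] with n hn hKn
  refine le_ciInf fun y => ?_
  by_cases hy : dist y x < δ
  · have h1 : (a : ℝ) < g y := by exact_mod_cast hball hy
    have h2 : 0 ≤ (K n : ℝ) * dist (z n) y := by positivity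
    linarith
  · have h1 : δ / 2 ≤ dist (z n) y := by
      have := dist_triangle y (z n) x
      rw [Set.mem_preimage, Metric.mem_ball] at hn
      rw [dist_comm y (z n)] at this
      linarith
    have h2 : (a : ℝ) / (δ / 2) ≤ K n := by
      have : ((a / (δ / 2).toNNReal : ℝ≥0) : ℝ) ≤ K n := by exact_mod_cast hKn
      rwa [NNReal.coe_div, Real.coe_toNNReal _ (half_pos hδ).le] at this
    rw [div_le_iff₀ (half_pos hδ)] at h2
    have h3 : (K n : ℝ) * (δ / 2) ≤ K n * dist (z n) y := by gcongr
    have h4 : (0 : ℝ) ≤ g y := (g y).2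
    linarith

end lipschitzEnvelope

/-! ### Wardrop equilibria for continuous costs. -/

namespace RoutingNetwork

variable {V E I : Type*} [DecidableEq E] [DecidableEq I] [Fintype I]
variable (N : RoutingNetwork V E I)

/-- A choice of one path for every commodity. -/
abbrev Profile : Type _ := ∀ i : I, {p : List E // p ∈ N.P i}

/-- The flow in which commodity `i` sends the fraction `x j` of its demand along `j i`,
for every profile `j`. -/
noncomputable def flowOfMixture (x : stdSimplex ℝ N.Profile) : N.demandFeasible :=
  ⟨fun s => N.Q s.1 * ∑ j : N.Profile with j s.1 = s.2, x.1 j,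
    fun s => mul_nonneg (N.Q s.1).2 (Finset.sum_nonneg fun j _ => x.2.1 j), fun i => by
      dsimp only
      rw [← Finset.mul_sum, Finset.sum_fiberwise Finset.univ (fun j : N.Profile => j i) x.1,
        x.2.2, mul_one]⟩

theorem continuous_flowOfMixture : Continuous N.flowOfMixture := by
  refine Continuous.subtype_mk (continuous_pi fun s => ?_) _
  exact continuous_const.mul (continuous_finsetSum _ fun j _ =>
    (continuous_apply j).comp continuous_subtype_val)

/-- Transfers support from flows back to mixtures; the positive demand is what lets the game's
weighted inequality be divided by `N.Q i`. -/
theorem exists_profile_of_flowOfMixture_pos {x : stdSimplex ℝ N.Profile} {i : I}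
    {p : {p : List E // p ∈ N.P i}} (h : 0 < (N.flowOfMixture x).1 ⟨i, p⟩) :
    0 < N.Q i ∧ ∃ j : N.Profile, j i = p ∧ 0 < x.1 j := by
  have h' : (0 : ℝ) < N.Q i * ∑ j : N.Profile with j i = p, x.1 j := h
  have hs : 0 < ∑ j : N.Profile with j i = p, x.1 j := pos_of_mul_pos_right h' (N.Q i).2
  refine ⟨by exact_mod_cast pos_of_mul_pos_left h' hs.le, ?_⟩
  obtain ⟨j, hj, hpos⟩ := Finset.exists_lt_of_sum_lt (s := {j : N.Profile | j i = p})
    (f := fun _ => (0 : ℝ)) (g := x.1) (by simpa using hs)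
  exact ⟨j, (Finset.mem_filter.1 hj).2, hpos⟩

/-- A Wardrop equilibrium exists for continuous edge costs. -/
theorem exists_wardrop_equilibrium {a : N.demandFeasible → I → E → ℝ}
    (ha : ∀ i e, Continuous fun f => a f i e) :
    ∃ f : N.demandFeasible, ∀ (i : I) (p q : {p : List E // p ∈ N.P i}), 0 < f.1 ⟨i, p⟩ →
      ∑ e ∈ p.1.toFinset, a f i e ≤ ∑ e ∈ q.1.toFinset, a f i e := by
  have : ∀ i, Nonempty {p : List E // p ∈ N.P i} := fun i => (N.nonempty_P i).to_subtype
  obtain ⟨x, hx⟩ := exists_stdSimplex_support_subset_argmin (J := N.Profile)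
    (G := fun x j => ∑ i, N.Q i * ∑ e ∈ (j i).1.toFinset, a (N.flowOfMixture x) i e)
    (fun j => continuous_finsetSum _ fun i _ => continuous_const.mul
      (continuous_finsetSum _ fun e _ => (ha i e).comp N.continuous_flowOfMixture))
  refine ⟨N.flowOfMixture x, fun i p q hp => ?_⟩
  obtain ⟨hQ, j, rfl, hj⟩ := N.exists_profile_of_flowOfMixture_pos hp
  -- Comparing with a profile changed only at `i` makes the terms of all other commodities cancel.
  have h := hx j hj (Function.update j i q)
  have hrest : ∑ k ∈ Finset.univ.erase i,
        N.Q k * ∑ e ∈ (Function.update j i q k).1.toFinset, a (N.flowOfMixture x) k e =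
      ∑ k ∈ Finset.univ.erase i, N.Q k * ∑ e ∈ (j k).1.toFinset, a (N.flowOfMixture x) k e :=
    Finset.sum_congr rfl fun k hk => by rw [Function.update_of_ne (Finset.mem_erase.1 hk).1]
  rw [← Finset.add_sum_erase _ _ (Finset.mem_univ i),
    ← Finset.add_sum_erase _ _ (Finset.mem_univ i), Function.update_self, hrest,
    add_le_add_iff_right] at h
  exact le_of_mul_le_mul_left h (by exact_mod_cast hQ)

theorem isCompact_demandFeasible : IsCompact N.demandFeasible := by
  have hcl : IsClosed N.demandFeasible := by
    have : N.demandFeasible = (⋂ s, {f | 0 ≤ f s}) ∩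
        ⋂ i, {f | ∑ p : {p : List E // p ∈ N.P i}, f ⟨i, p⟩ = (N.Q i : ℝ)} := by
      ext f
      simp [demandFeasible]
    rw [this]
    refine (isClosed_iInter fun s => isClosed_le continuous_const (continuous_apply s)).inter
      (isClosed_iInter fun i => isClosed_eq (continuous_finsetSum _ fun p _ =>
        continuous_apply _) continuous_const)
  refine IsCompact.of_isClosed_subset (isCompact_Icc (a := 0) (b := fun s => (N.Q s.1 : ℝ))) hcl ?_
  refine fun f hf => ⟨fun s => hf.1 s, fun s => ?_⟩
  dsimp only
  rw [← hf.2 s.1]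
  exact Finset.single_le_sum (f := fun p => f ⟨s.1, p⟩) (fun p _ => hf.1 _) (Finset.mem_univ s.2)

/-! ### Passage to the limit and upper hulls. -/

variable {N}

namespace CostStructure

variable {c : N.CostStructure}

theorem upperHull_ne_top (hbdd : c.IsBounded) (i : I) (e : E) (f : N.demandFeasible) :
    c.upperHull i e f ≠ ⊤ := by
  obtain ⟨M, hM⟩ := hbdd
  refine ne_top_of_le_ne_top (ENNReal.coe_ne_top (r := M)) ?_
  refine (iInf₂_le (1 : ℝ) one_pos).trans (iSup₂_le fun x _ => ?_)
  exact_mod_cast hM x i e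

theorem eventually_le_upperHull_add (hbdd : c.IsBounded) (i : I) (e : E)
    (f : N.demandFeasible) {δ : ℝ} (hδ : 0 < δ) :
    ∀ᶠ x in 𝓝 f, (c x i e : ℝ) ≤ (c.upperHull i e f).toReal + δ := by
  have hfin := upperHull_ne_top hbdd i e f
  have hlt : c.upperHull i e f < c.upperHull i e f + ENNReal.ofReal δ :=
    ENNReal.lt_add_right hfin (by simpa using hδ)
  obtain ⟨r, hlt⟩ := iInf_lt_iff.1 hlt
  obtain ⟨hr, hlt⟩ := iInf_lt_iff.1 hlt
  filter_upwards [Metric.ball_mem_nhds f hr] with x hx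
  have h : (c x i e : ℝ≥0∞) ≤ c.upperHull i e f + ENNReal.ofReal δ :=
    (le_iSup₂ (f := fun x (_ : x ∈ Metric.ball f r) => (c x i e : ℝ≥0∞)) x hx).trans hlt.le
  have h' := ENNReal.toReal_mono (ENNReal.add_ne_top.2 ⟨hfin, ENNReal.ofReal_ne_top⟩) h
  rwa [ENNReal.toReal_add hfin ENNReal.ofReal_ne_top, ENNReal.toReal_ofReal hδ.le] at h'

/-- Common edges contribute the same cost at `f` to both sides. Boundedness makes the hulls finite,
so the remaining comparison can be made in the reals. -/
theorem pathCost_le_hullCost (hbdd : c.IsBounded) {i : I} {p q : {p : List E // p ∈ N.P i}}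
    {f : N.demandFeasible}
    (h : ∑ e ∈ p.1.toFinset \ q.1.toFinset, (c f i e : ℝ) ≤
      ∑ e ∈ q.1.toFinset \ p.1.toFinset, (c.upperHull i e f).toReal) :
    (c.pathCost i p f : ℝ≥0∞) ≤ c.hullCost i p q f := by
  rw [pathCost, hullCost, ← Finset.sum_inter_add_sum_sdiff p.1.toFinset q.1.toFinset,
    ENNReal.coe_add, ENNReal.ofNNReal_finsetSum, ENNReal.ofNNReal_finsetSum]
  gcongr
  have hfin : ∑ e ∈ q.1.toFinset \ p.1.toFinset, c.upperHull i e f ≠ ⊤ :=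
    ENNReal.sum_ne_top.2 fun e _ => upperHull_ne_top hbdd i e f
  rw [← ENNReal.toReal_le_toReal (ENNReal.sum_ne_top.2 fun e _ => ENNReal.coe_ne_top) hfin,
    ENNReal.toReal_sum fun e _ => ENNReal.coe_ne_top,
    ENNReal.toReal_sum fun e _ => upperHull_ne_top hbdd i e f]
  simpa using h

/-- For bounded lower semicontinuous costs some flow uses only paths whose cost does not exceed
the hull cost of any alternative. -/
theorem exists_pathCost_le_hullCost (hlsc : c.IsLowerSemicontinuous) (hbdd : c.IsBounded) :
    ∃ f : N.demandFeasible, ∀ (i : I) (p q : {p : List E // p ∈ N.P i}), 0 < f.1 ⟨i, p⟩ →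
      (c.pathCost i p f : ℝ≥0∞) ≤ c.hullCost i p q f := by
  choose z hz using fun n : ℕ => N.exists_wardrop_equilibrium
    (a := fun f i e => lipschitzEnvelope (fun x => c x i e) n f)
    fun i e => continuous_lipschitzEnvelope _ _
  have : CompactSpace N.demandFeasible := isCompact_iff_compactSpace.1 N.isCompact_demandFeasible
  obtain ⟨f, φ, hφ, hf⟩ := CompactSpace.tendsto_subseq z
  refine ⟨f, fun i p q hp => pathCost_le_hullCost hbdd ?_⟩
  have hK : Filter.Tendsto (fun n => ((φ n : ℕ) : ℝ≥0)) Filter.atTop Filter.atTop :=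
    tendsto_natCast_atTop_atTop.comp hφ.tendsto_atTop
  have hfp : Filter.Tendsto (fun n => (z (φ n)).1 ⟨i, p⟩) Filter.atTop (𝓝 (f.1 ⟨i, p⟩)) :=
    (((continuous_apply _).comp continuous_subtype_val).tendsto f).comp hf
  -- A margin `δ` per edge turns both semicontinuity bounds into eventual inequalities that hold at
  -- one common index; it is sent to zero afterwards.
  have hδ : ∀ δ : ℝ, 0 < δ → ∑ e ∈ p.1.toFinset \ q.1.toFinset, ((c f i e : ℝ) - δ) ≤
      ∑ e ∈ q.1.toFinset \ p.1.toFinset, ((c.upperHull i e f).toReal + δ) := by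
    intro δ hδ
    have h1 : ∀ᶠ n in Filter.atTop, ∀ e ∈ p.1.toFinset \ q.1.toFinset,
        (c f i e : ℝ) - δ ≤ lipschitzEnvelope (fun x => c x i e) (φ n) (z (φ n)) :=
      (Filter.eventually_all_finset _).2 fun e _ =>
        LowerSemicontinuousAt.eventually_le_lipschitzEnvelope (hlsc i e f) hf hK (sub_lt_self _ hδ)
    have h2 : ∀ᶠ n in Filter.atTop, ∀ e ∈ q.1.toFinset \ p.1.toFinset,
        (c (z (φ n)) i e : ℝ) ≤ (c.upperHull i e f).toReal + δ :=
      (Filter.eventually_all_finset _).2 fun e _ =>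
        hf.eventually (eventually_le_upperHull_add hbdd i e f hδ)
    obtain ⟨n, h1, h2, hn⟩ := (h1.and (h2.and (hfp.eventually (lt_mem_nhds hp)))).exists
    have h := hz (φ n) i p q hn
    -- Common edges are cancelled while both paths are still priced at the same approximate flow.
    rw [← Finset.sum_inter_add_sum_sdiff p.1.toFinset q.1.toFinset,
      ← Finset.sum_inter_add_sum_sdiff q.1.toFinset p.1.toFinset,
      Finset.inter_comm q.1.toFinset, add_le_add_iff_left] at h
    refine (Finset.sum_le_sum h1).trans (h.trans (Finset.sum_le_sum fun e he => ?_))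
    exact (lipschitzEnvelope_le _ _ _).trans (h2 e he)
  have hl : Filter.Tendsto (fun δ : ℝ => ∑ e ∈ p.1.toFinset \ q.1.toFinset, ((c f i e : ℝ) - δ))
      (𝓝[>] 0) (𝓝 (∑ e ∈ p.1.toFinset \ q.1.toFinset, ((c f i e : ℝ) - 0))) :=
    (Continuous.tendsto (by fun_prop) 0).mono_left nhdsWithin_le_nhds
  have hr : Filter.Tendsto
      (fun δ : ℝ => ∑ e ∈ q.1.toFinset \ p.1.toFinset, ((c.upperHull i e f).toReal + δ))
      (𝓝[>] 0) (𝓝 (∑ e ∈ q.1.toFinset \ p.1.toFinset, ((c.upperHull i e f).toReal + 0))) :=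
    (Continuous.tendsto (by fun_prop) 0).mono_left nhdsWithin_le_nhds
  simpa using le_of_tendsto_of_tendsto hl hr (eventually_mem_nhdsWithin.mono hδ)

end CostStructure

end RoutingNetwork

theorem theorem10 {V E I : Type*} [DecidableEq E] [Fintype I] [DecidableEq I]
    (N : RoutingNetwork V E I) (c : N.CostStructure)
    (hlsc : c.IsLowerSemicontinuous) (hbdd : c.IsBounded) (hreg : c.WeaklyRegular) :
    ∃ f : N.demandFeasible, c.IsBSEquilibrium f := by
  obtain ⟨f, hf⟩ := RoutingNetwork.CostStructure.exists_pathCost_le_hullCost hlsc hbdd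
  exact ⟨f, fun i p hp q => (hreg f i p hp (le_iInf fun r => hf i p r hp)).trans (iInf_le _ q)⟩
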